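/- Let $\mathbb{T}$ be the unit circle with normalized Lebesgue measure $m$, let $L^2$ and $L^\infty$ be taken over $(\mathbb{T},m)$, and let $H^2\subseteq L^2$ be the Hardy space of the unit disc $\mathbb{D}$, identified with its space of boundary functions. Let $H^\infty$ be the algebra of bounded analytic functions on $\mathbb{D}$. For $g\in L^\infty$ let $T_g:H^2\to H^2$, $T_gf=P_{H^2}(gf)$, be the Toeplitz operator with symbol $g$, where $P_{H^2}$ is the orthogonal projection of $L^2$ onto $H^2$. Let $F\in L^\infty\setminus\{0\}$ and let $u\in H^2$ be outer, that is, $u(z)=\alpha\exp\left(\int_{\mathbb{T}}\frac{\zeta+z}{\zeta-z}k(\zeta)\,dm(\zeta)\right)$ on $\mathbb{D}$ for some $\alpha\in\mathbb{C}$ with $|\alpha|=1$ and some real-valued integrable function $k$ on $\mathbb{T}$. Suppose that $\operatorname{Ker}T_F\neq\{0\}$, that $u\operatorname{Ker}T_F:=\{uf: f\in\operatorname{Ker}T_F\}\subseteq H^2$, and that $u^{-1}\in H^\infty$. Then $F\overline{u}/u$ and $F/u$ belong to $L^\infty$, and $$u\operatorname{Ker}T_F=\operatorname{Ker}T_{F\overline{u}/u}=\operatorname{Ker}T_{F/u}.$$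 In particular, $u\operatorname{Ker}T_F$ is a Toeplitz kernel, that is, it equals $\operatorname{Ker}T_g$ for some $g\in L^\infty$. -/

import Mathlib

namespace HardyToeplitz

open MeasureTheory ComplexConjugate
open scoped ENNReal

noncomputable section

/-- The unit circle, parametrised by `x ↦ exp (2 π i x)` on `ℝ / ℤ`. -/
abbrev T : Type := UnitAddCircle

/-- Normalised Lebesgue (arc length) measure on the circle. -/
abbrev m : Measure T := AddCircle.haarAddCircle

/-- The complex number `ζ = exp (2 π i x)` of modulus one that corresponds to `x : T`. -/
def zeta (x : T) : ℂ := AddCircle.toCircle x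

/-- `L²` of the circle. -/
abbrev L2 : Type := Lp ℂ 2 m

/-- `L^∞` of the circle. -/
abbrev LInf : Type := Lp ℂ ∞ m

/-- The Hardy space `H²`, identified with the space of its boundary functions: the closed linear
span in `L²` of the monomials `ζ ^ n`, `n ≥ 0`. -/
def H2 : Submodule ℂ L2 :=
  (Submodule.span ℂ (Set.range fun n : ℕ => (fourierLp 2 (n : ℤ) : L2))).topologicalClosure

instance : H2.HasOrthogonalProjection :=
  inferInstanceAs (Submodule.HasOrthogonalProjection (Submodule.topologicalClosure _))

/-- The analytic function on the unit disc whose boundary function is `f ∈ H²`, recovered by the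
Cauchy integral `f(z) = ∫ f(ζ) / (1 - conj ζ * z) dm(ζ)` for `|z| < 1`. -/
def onDisc (f : L2) (z : ℂ) : ℂ := ∫ x, f x / (1 - conj (zeta x) * z) ∂m

/-- `H^∞`: the bounded analytic functions on the unit disc. -/
def IsHInf (h : ℂ → ℂ) : Prop :=
  DifferentiableOn ℂ h (Metric.ball 0 1) ∧ ∃ C : ℝ, ∀ z ∈ Metric.ball (0 : ℂ) 1, ‖h z‖ ≤ C

/-- `f ∈ H²` is outer: `f(z) = α exp (∫ (ζ + z) / (ζ - z) k(ζ) dm(ζ))` on the disc, for a real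
integrable function `k` on the circle and a constant `α` of modulus one. -/
def IsOuter (f : L2) : Prop :=
  f ∈ H2 ∧ ∃ (α : ℂ) (k : T → ℝ), ‖α‖ = 1 ∧ Integrable k m ∧
    ∀ z ∈ Metric.ball (0 : ℂ) 1,
      onDisc f z = α * Complex.exp (∫ x, (zeta x + z) / (zeta x - z) * (k x : ℂ) ∂m)

/-- Multiplication by `g ∈ L^∞` on `L²`. -/
def mulOp (g : LInf) : L2 →L[ℂ] L2 :=
  (ContinuousLinearMap.mul ℂ ℂ).holderL m ∞ 2 2 g

/-- The Toeplitz operator `T_g f = P (g f)` on `H²`, with `P` the orthogonal projection of `L²`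
onto `H²`. -/
def toeplitz (g : LInf) : H2 →L[ℂ] H2 :=
  H2.orthogonalProjectionOnto ∘L mulOp g ∘L H2.subtypeL

/-- `Ker T_g`, as a subspace of `H² ⊆ L²`. -/
def toeplitzKer (g : LInf) : Submodule ℂ L2 :=
  (LinearMap.ker (toeplitz g : H2 →ₗ[ℂ] H2)).map H2.subtype

/-- A subspace of `L²` as a set of measurable functions on the circle (modulo null sets). -/
def classes (K : Submodule ℂ L2) : Set (T →ₘ[m] ℂ) := {φ | ∃ f ∈ K, φ = (f : T →ₘ[m] ℂ)}

/-- `u K = {u f : f ∈ K}`; the products are measurable functions on the circle (modulo null sets)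
that need not be in `L²`. -/
def mulSet (u : L2) (K : Submodule ℂ L2) : Set (T →ₘ[m] ℂ) :=
  {φ | ∃ f ∈ K, φ = (u : T →ₘ[m] ℂ) * (f : T →ₘ[m] ℂ)}

/-- The set `M` of functions is the kernel of some Toeplitz operator with symbol in `L^∞`. -/
def IsToeplitzKernel (M : Set (T →ₘ[m] ℂ)) : Prop := ∃ g : LInf, M = classes (toeplitzKer g)

end

end HardyToeplitz

/-!
Since `u` is outer, `u` has no zero in the disc, so `1 / u` is a genuine bounded analytic function.
It has a boundary function `v ∈ H²`: the radial dilations of a bounded power series are bounded in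
`L²`, so by Parseval its coefficients are square summable. The dilations of `u` and of `1 / u`
converge in `L²` to `u` and `v`, hence almost everywhere along a common sequence of radii, so `v`
is bounded and `u v = 1` almost everywhere (`exists_bounded_boundary_inverse`). In particular
`F / u = F v` is bounded, and so is `F ū / u`, whose modulus is at most that of `F`.

A function `f ∈ H²` lies in `Ker T_F` exactly when `F f` is orthogonal to `H²`. If `f ∈ Ker T_F`,
then `u f ∈ H²` by hypothesis, `(F / u) (u f) = F f` and `(F ū / u) (u f) = ū (F f)`. Conversely,
if `p ∈ H²` lies in one of the other two kernels, then `f = v p` is in `H²`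
(`mem_H2_of_eq_mul`), `u f = p`, and `F f` equals `(F / u) p` and `v̄ ((F ū / u) p)`. It remains to
know that multiplying by the conjugate of a function of `H²`, as long as the product is in `L²`,
preserves orthogonality to `H²` (`mem_orthogonal_H2_of_eq_mul_conj`); this and the stability of
`H²` under products are read off from Fourier coefficients.
-/

namespace HardyToeplitz

open MeasureTheory ComplexConjugate Filter Topology
open scoped ENNReal

noncomputable section

/-! ### Fourier coefficients and the Hardy space -/

lemma fourier_natCast_eq_zeta_pow (n : ℕ) (x : T) : fourier (n : ℤ) x = zeta x ^ n := by
  simp [zeta, fourier_apply, AddCircle.toCircle_nsmul]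

lemma norm_zeta (x : T) : ‖zeta x‖ = 1 := Circle.norm_coe _

lemma conj_zeta_pow (n : ℕ) (x : T) : conj (zeta x) ^ n = fourier (-(n : ℤ)) x := by
  rw [fourier_neg, fourier_natCast_eq_zeta_pow, map_pow]

lemma inner_fourierLp_eq_fourierCoeff (f : L2) (n : ℤ) :
    inner ℂ (fourierLp 2 n : L2) f = fourierCoeff f n := by
  rw [← fourierBasis_repr, HilbertBasis.repr_apply_apply, coe_fourierBasis]

lemma fourierLp_mem_H2 (n : ℕ) : (fourierLp 2 (n : ℤ) : L2) ∈ H2 :=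
  Submodule.le_topologicalClosure _ (Submodule.subset_span ⟨n, rfl⟩)

lemma mem_orthogonal_H2_iff (f : L2) : f ∈ H2ᗮ ↔ ∀ n : ℕ, fourierCoeff f n = 0 := by
  constructor
  · intro h n
    rw [← inner_fourierLp_eq_fourierCoeff]
    exact h _ (fourierLp_mem_H2 n)
  · intro h
    rw [H2, Submodule.orthogonal_closure, Submodule.mem_orthogonal]
    intro g hg
    induction hg using Submodule.span_induction with
    | mem g hg =>
      obtain ⟨n, rfl⟩ := hg
      rw [inner_fourierLp_eq_fourierCoeff, h n]
    | zero => simp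
    | add a b _ _ ha hb => simp [inner_add_left, ha, hb]
    | smul c a _ ha => simp [inner_smul_left, ha]

lemma mem_H2_of_hasSum {c : ℕ → ℂ} {f : L2}
    (h : HasSum (fun n : ℕ => c n • (fourierLp 2 (n : ℤ) : L2)) f) : f ∈ H2 :=
  (Submodule.isClosed_topologicalClosure _).mem_of_tendsto h
    (Eventually.of_forall fun _ =>
      Submodule.sum_mem _ fun n _ => Submodule.smul_mem _ _ (fourierLp_mem_H2 n))

lemma fourierCoeff_of_neg_of_mem_H2 {f : L2} (hf : f ∈ H2) {n : ℤ} (hn : n < 0) :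
    fourierCoeff f n = 0 := by
  have key : ∀ g ∈ H2, inner ℂ (fourierLp 2 n : L2) g = 0 := by
    have h1 : H2 ≤ (Submodule.span ℂ {(fourierLp 2 n : L2)})ᗮ := by
      refine Submodule.topologicalClosure_minimal _ ?_ (Submodule.isClosed_orthogonal _)
      rw [Submodule.span_le]
      rintro _ ⟨k, rfl⟩
      rw [SetLike.mem_coe, Submodule.mem_orthogonal_singleton_iff_inner_right]
      exact orthonormal_fourier.2 (by omega)
    intro g hg
    exact Submodule.mem_orthogonal_singleton_iff_inner_right.1 (h1 hg)
  rw [← inner_fourierLp_eq_fourierCoeff, key f hf]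

lemma hasSum_of_fourierCoeff_neg_eq_zero {f : L2} (hf : ∀ n : ℤ, n < 0 → fourierCoeff f n = 0) :
    HasSum (fun n : ℕ => fourierCoeff f n • (fourierLp 2 (n : ℤ) : L2)) f := by
  have h := hasSum_fourier_series_L2 f
  rw [← Function.Injective.hasSum_iff (g := ((↑) : ℕ → ℤ)) Nat.cast_injective] at h
  · exact h
  · intro n hn
    rw [hf n, zero_smul]
    by_contra hn'
    exact hn ⟨n.toNat, by simpa using hn'⟩

lemma mem_H2_iff (f : L2) : f ∈ H2 ↔ ∀ n : ℤ, n < 0 → fourierCoeff f n = 0 :=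
  ⟨fun hf _ => fourierCoeff_of_neg_of_mem_H2 hf,
    fun hf => mem_H2_of_hasSum (hasSum_of_fourierCoeff_neg_eq_zero hf)⟩

lemma fourierCoeff_eq_of_hasSum {c : ℕ → ℂ} {f : L2}
    (h : HasSum (fun n : ℕ => c n • (fourierLp 2 (n : ℤ) : L2)) f) (n : ℕ) :
    fourierCoeff f n = c n := by
  have h1 := h.mapL (innerSL ℂ (fourierLp 2 (n : ℤ) : L2))
  have h2 : HasSum (fun k : ℕ => innerSL ℂ (fourierLp 2 (n : ℤ) : L2)
      (c k • (fourierLp 2 (k : ℤ) : L2))) (c n) := by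
    convert! hasSum_ite_eq n (c n) using 2 with k
    rw [innerSL_apply_apply, inner_smul_right, orthonormal_iff_ite.1 orthonormal_fourier]
    by_cases hk : k = n
    · simp [hk]
    · simp [hk, Ne.symm hk]
  rw [← inner_fourierLp_eq_fourierCoeff]
  exact h1.unique h2

lemma hasSum_norm_sq {c : ℕ → ℂ} {f : L2}
    (h : HasSum (fun n : ℕ => c n • (fourierLp 2 (n : ℤ) : L2)) f) :
    HasSum (fun n => ‖c n‖ ^ 2) (‖f‖ ^ 2) := by
  have h1 : HasSum (fun i => ‖fourierBasis.repr f i‖ ^ 2) (‖fourierBasis.repr f‖ ^ 2) := by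
    apply_mod_cast lp.hasSum_norm ?_ (fourierBasis.repr f)
    simp
  rw [LinearIsometryEquiv.norm_map,
    ← Function.Injective.hasSum_iff (g := ((↑) : ℕ → ℤ)) Nat.cast_injective] at h1
  · convert! h1 using 2 with n
    simp [fourierBasis_repr, fourierCoeff_eq_of_hasSum h]
  · intro n hn
    rw [fourierBasis_repr, fourierCoeff_of_neg_of_mem_H2 (mem_H2_of_hasSum h)]
    · simp
    by_contra hn'
    exact hn ⟨n.toNat, by simpa using hn'⟩

lemma exists_hasSum_of_summable_sq {c : ℕ → ℂ} (hc : Summable fun n => ‖c n‖ ^ 2) :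
    ∃ f : L2, HasSum (fun n : ℕ => c n • (fourierLp 2 (n : ℤ) : L2)) f := by
  have ho : Orthonormal ℂ (fun n : ℕ => (fourierLp 2 (n : ℤ) : L2)) :=
    orthonormal_fourier.comp _ Nat.cast_injective
  have := (ho.orthogonalFamily.summable_iff_norm_sq_summable c).2 hc
  exact ⟨_, by simpa using this.hasSum⟩

lemma fourierCoeff_fourier_mul (f : T → ℂ) (j n : ℤ) :
    fourierCoeff (fun x => fourier j x * f x) n = fourierCoeff f (n - j) := by
  unfold fourierCoeff
  congr 1
  ext x
  rw [show -(n - j) = -n + j by ring, fourier_add]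
  simp only [smul_eq_mul, mul_assoc]

lemma fourierCoeff_conj (f : T → ℂ) (n : ℤ) :
    fourierCoeff (fun x => conj (f x)) n = conj (fourierCoeff f (-n)) := by
  unfold fourierCoeff
  rw [← integral_conj]
  congr 1
  ext x
  simp

/-! ### Products with functions of the Hardy space -/

lemma memLp_fourier_mul (f : L2) (j : ℤ) : MemLp (fun x => fourier j x * f x) 2 m := by
  refine (Lp.memLp f).of_le
    ((fourier j).continuous.aestronglyMeasurable.mul (Lp.aestronglyMeasurable f)) ?_
  exact Eventually.of_forall fun x => by
    rw [norm_mul, fourier_apply, Circle.norm_coe, one_mul]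

/-- Multiplication by the conjugate of a function of `H²` preserves orthogonality to `H²`:
testing the product against `ζ ^ n` amounts to testing `φ` against `ζ ^ n * h`, which lies in
`H²`. -/
lemma mem_orthogonal_H2_of_eq_mul_conj {φ h ψ : L2} (hφ : φ ∈ H2ᗮ) (hh : h ∈ H2)
    (hψ : ∀ᵐ x ∂m, ψ x = φ x * conj (h x)) : ψ ∈ H2ᗮ := by
  rw [mem_orthogonal_H2_iff]
  intro n
  have hs : (memLp_fourier_mul h n).toLp _ ∈ H2 := by
    rw [mem_H2_iff]
    intro k hk
    rw [fourierCoeff_congr_ae (MemLp.coeFn_toLp _), fourierCoeff_fourier_mul]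
    exact fourierCoeff_of_neg_of_mem_H2 hh (by omega)
  rw [← hφ _ hs, L2.inner_def]
  refine integral_congr_ae ?_
  filter_upwards [hψ, (memLp_fourier_mul h n).coeFn_toLp] with x hx hy
  rw [hx, hy]
  simp only [RCLike.inner_apply, map_mul, fourier_neg, smul_eq_mul]
  ring

/-- A product of functions of `H²` that is square integrable is in `H²`: its negative Fourier
coefficients pair `g` with the conjugate of `ζ ^ k * h`, `k ≥ 1`, which is orthogonal to `H²`. -/
lemma mem_H2_of_eq_mul {g h ψ : L2} (hg : g ∈ H2) (hh : h ∈ H2)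
    (hψ : ∀ᵐ x ∂m, ψ x = g x * h x) : ψ ∈ H2 := by
  rw [mem_H2_iff]
  intro n hn
  have hs : (memLp_fourier_mul h (-n)).star.toLp _ ∈ H2ᗮ := by
    rw [mem_orthogonal_H2_iff]
    intro k
    rw [fourierCoeff_congr_ae (MemLp.coeFn_toLp _)]
    refine (fourierCoeff_conj _ _).trans ?_
    rw [fourierCoeff_fourier_mul, fourierCoeff_of_neg_of_mem_H2 hh (by omega), map_zero]
  have h0 := inner_eq_zero_symm.1 (hs _ hg)
  rw [← h0, L2.inner_def]
  refine integral_congr_ae ?_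
  filter_upwards [hψ, (memLp_fourier_mul h (-n)).star.coeFn_toLp] with x hx hy
  rw [hx, hy]
  simp only [RCLike.inner_apply, smul_eq_mul, Pi.star_apply, RCLike.star_def, RCLike.conj_conj]
  ring

/-! ### Toeplitz kernels -/

lemma coeFn_mulOp (g : LInf) (f : L2) : ∀ᵐ x ∂m, mulOp g f x = g x * f x := by
  filter_upwards [(ContinuousLinearMap.mul ℂ ℂ).coeFn_holder (r := 2) g f] with x hx
  exact hx

lemma mem_toeplitzKer_iff (g : LInf) (f : L2) :
    f ∈ toeplitzKer g ↔ f ∈ H2 ∧ mulOp g f ∈ H2ᗮ := by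
  simp only [toeplitzKer, Submodule.mem_map, LinearMap.mem_ker]
  constructor
  · rintro ⟨f, hf, rfl⟩
    refine ⟨f.2, ?_⟩
    rw [← Submodule.orthogonalProjectionOnto_eq_zero_iff]
    exact hf
  · rintro ⟨hf, hg⟩
    refine ⟨⟨f, hf⟩, ?_, rfl⟩
    rw [← Submodule.orthogonalProjectionOnto_eq_zero_iff] at hg
    exact hg

/-! ### Radial dilations and boundary functions -/

lemma hasSum_onDisc (f : L2) {z : ℂ} (hz : z ∈ Metric.ball (0 : ℂ) 1) :
    HasSum (fun n : ℕ => fourierCoeff f n * z ^ n) (onDisc f z) := by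
  have hz1 : ‖z‖ < 1 := by simpa using hz
  have hf : Integrable f m := (Lp.memLp f).integrable (by norm_num)
  let A : ℕ → T → ℂ := fun n x => z ^ n * (fourier (-(n : ℤ)) x • f x)
  have hA : ∀ n, Integrable (A n) m := fun n => (hf.fourier_smul _).const_mul _
  have hnorm : ∀ n, ∫ x, ‖A n x‖ ∂m = ‖z‖ ^ n * ∫ x, ‖f x‖ ∂m := by
    intro n
    rw [← integral_const_mul]
    congr 1
    ext x
    rw [norm_mul, norm_smul, fourier_apply, Circle.norm_coe, one_mul, norm_pow]
  have hsum : Summable fun n => ∫ x, ‖A n x‖ ∂m := by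
    simp_rw [hnorm]
    exact (summable_geometric_of_lt_one (norm_nonneg z) hz1).mul_right _
  have h := hasSum_integral_of_summable_integral_norm hA hsum
  have hl : ∀ n, ∫ x, A n x ∂m = fourierCoeff f n * z ^ n := by
    intro n
    rw [integral_const_mul, mul_comm, fourierCoeff]
  have hr : ∫ x, ∑' n, A n x ∂m = onDisc f z := by
    unfold onDisc
    congr 1
    ext x
    have hq : ‖conj (zeta x) * z‖ < 1 := by
      rw [norm_mul, RCLike.norm_conj, norm_zeta, one_mul]; exact hz1
    rw [div_eq_mul_inv, ← tsum_geometric_of_norm_lt_one hq, ← tsum_mul_left]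
    refine tsum_congr fun n => ?_
    simp only [A]
    rw [mul_pow, conj_zeta_pow, smul_eq_mul]
    ring
  rw [hr] at h
  simpa only [hl] using h

lemma mul_zeta_mem_ball {r : ℝ} (hr0 : 0 ≤ r) (hr1 : r < 1) (x : T) :
    (r : ℂ) * zeta x ∈ Metric.ball (0 : ℂ) 1 := by
  simpa [norm_zeta, abs_of_nonneg hr0] using hr1

/-- The radial dilation `ζ ↦ ∑ cₙ rⁿ ζⁿ` of the power series with coefficients `c`, as a
continuous function on the circle. -/
def radial (c : ℕ → ℂ) (r : ℝ) : C(T, ℂ) := ∑' n : ℕ, (c n * (r : ℂ) ^ n) • fourier (n : ℤ)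

section radial

variable {c : ℕ → ℂ} {G : ℂ → ℂ}
  (hG : ∀ z ∈ Metric.ball (0 : ℂ) 1, HasSum (fun n => c n * z ^ n) (G z))
  {r : ℝ} (hr0 : 0 ≤ r) (hr1 : r < 1)

include hG hr0 hr1

lemma hasSum_radial :
    HasSum (fun n : ℕ => (c n * (r : ℂ) ^ n) • (fourier (n : ℤ) : C(T, ℂ))) (radial c r) := by
  refine Summable.hasSum (Summable.of_norm ?_)
  have := (hG r (by simpa [abs_of_nonneg hr0] using hr1)).summable.norm
  simpa only [norm_smul, fourier_norm, mul_one, norm_mul] using this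

lemma radial_apply (x : T) : radial c r x = G (r * zeta x) := by
  have h1 := (ContinuousMap.evalCLM ℂ x).hasSum (hasSum_radial hG hr0 hr1)
  refine h1.unique ?_
  convert! hG _ (mul_zeta_mem_ball hr0 hr1 x) using 2 with n
  simp only [ContinuousMap.evalCLM_apply, ContinuousMap.smul_apply,
    smul_eq_mul]
  rw [fourier_natCast_eq_zeta_pow, mul_pow, mul_assoc]

lemma hasSum_toLp_radial :
    HasSum (fun n : ℕ => (c n * (r : ℂ) ^ n) • (fourierLp 2 (n : ℤ) : L2))
      (ContinuousMap.toLp (E := ℂ) 2 m ℂ (radial c r)) := by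
  have := (ContinuousMap.toLp (E := ℂ) 2 m ℂ).hasSum (hasSum_radial hG hr0 hr1)
  exact this

end radial

/-- The radial dilations of a function in `H²` tend to it in `L²`, by Parseval and dominated
convergence for the Fourier coefficients. -/
lemma tendsto_toLp_radial {c : ℕ → ℂ} {G : ℂ → ℂ}
    (hG : ∀ z ∈ Metric.ball (0 : ℂ) 1, HasSum (fun n => c n * z ^ n) (G z)) {f : L2}
    (hf : HasSum (fun n : ℕ => c n • (fourierLp 2 (n : ℤ) : L2)) f) {r : ℕ → ℝ}
    (hr0 : ∀ k, 0 ≤ r k) (hr1 : ∀ k, r k < 1) (hr : Tendsto r atTop (𝓝 1)) :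
    Tendsto (fun k => ContinuousMap.toLp (E := ℂ) 2 m ℂ (radial c (r k))) atTop (𝓝 f) := by
  have hsq : ∀ k, HasSum (fun n => ‖c n * (r k : ℂ) ^ n - c n‖ ^ 2)
      (‖ContinuousMap.toLp (E := ℂ) 2 m ℂ (radial c (r k)) - f‖ ^ 2) := by
    intro k
    refine hasSum_norm_sq ?_
    simpa only [sub_smul] using (hasSum_toLp_radial hG (hr0 k) (hr1 k)).sub hf
  have hlim : Tendsto (fun k => ∑' n, ‖c n * (r k : ℂ) ^ n - c n‖ ^ 2) atTop
      (𝓝 (∑' _ : ℕ, (0 : ℝ))) := by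
    refine tendsto_tsum_of_dominated_convergence (hasSum_norm_sq hf).summable ?_ ?_
    · intro n
      have h1 : Tendsto (fun k => (r k : ℂ)) atTop (𝓝 ((1 : ℝ) : ℂ)) :=
        (Complex.continuous_ofReal.tendsto 1).comp hr
      have h2 := ((((h1.pow n).const_mul (c n)).sub_const (c n)).norm.pow 2)
      simpa using h2
    · refine Eventually.of_forall fun k n => ?_
      have h3 : ‖c n * (r k : ℂ) ^ n - c n‖ ≤ ‖c n‖ := by
        have h4 : c n * (r k : ℂ) ^ n - c n = c n * (((r k) ^ n - 1 : ℝ) : ℂ) := by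
          push_cast; ring
        rw [h4, norm_mul, Complex.norm_real, Real.norm_eq_abs]
        refine mul_le_of_le_one_right (norm_nonneg _) ?_
        have h5 := pow_nonneg (hr0 k) n
        have h6 := pow_le_one₀ (n := n) (hr0 k) (hr1 k).le
        rw [abs_le]
        constructor <;> linarith
      rw [Real.norm_of_nonneg (by positivity)]
      gcongr
  simp only [tsum_zero, (hsq _).tsum_eq] at hlim
  rw [tendsto_iff_norm_sub_tendsto_zero]
  have := hlim.sqrt
  simpa using this

/-- The Taylor coefficients of a bounded analytic function are square summable, since Parseval
bounds the norms of its dilations uniformly in the radius. -/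
lemma summable_sq_of_bounded {c : ℕ → ℂ} {G : ℂ → ℂ}
    (hG : ∀ z ∈ Metric.ball (0 : ℂ) 1, HasSum (fun n => c n * z ^ n) (G z)) {C : ℝ}
    (hC : ∀ z ∈ Metric.ball (0 : ℂ) 1, ‖G z‖ ≤ C) : Summable fun n => ‖c n‖ ^ 2 := by
  have hC0 : 0 ≤ C := (norm_nonneg _).trans (hC 0 (by simp))
  have hbound : ∀ r : ℝ, 0 ≤ r → r < 1 → ∀ s : Finset ℕ,
      ∑ n ∈ s, ‖c n * (r : ℂ) ^ n‖ ^ 2 ≤ C ^ 2 := by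
    intro r hr0 hr1 s
    have h1 := hasSum_norm_sq (hasSum_toLp_radial hG hr0 hr1)
    refine (sum_le_hasSum s (fun _ _ => by positivity) h1).trans ?_
    have h2 : ‖ContinuousMap.toLp (E := ℂ) 2 m ℂ (radial c r)‖ ≤ C := by
      refine (Lp.norm_le_of_ae_bound hC0 (C := C) ?_).trans ?_
      · filter_upwards [ContinuousMap.coeFn_toLp (p := 2) (𝕜 := ℂ) m (radial c r)] with x hx
        rw [hx, radial_apply hG hr0 hr1]
        exact hC _ (mul_zeta_mem_ball hr0 hr1 x)
      · rw [measureUnivNNReal, measure_univ]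
        simp
    gcongr
  refine summable_of_sum_le (c := C ^ 2) (fun _ => by positivity) fun s => ?_
  have hcont : Continuous fun r : ℝ => ∑ n ∈ s, ‖c n * (r : ℂ) ^ n‖ ^ 2 := by fun_prop
  have hlim : Tendsto (fun r : ℝ => ∑ n ∈ s, ‖c n * (r : ℂ) ^ n‖ ^ 2) (𝓝[<] 1)
      (𝓝 (∑ n ∈ s, ‖c n‖ ^ 2)) := by
    have := (hcont.tendsto 1).mono_left (nhdsWithin_le_nhds (s := Set.Iio 1))
    simpa using this
  refine le_of_tendsto hlim ?_
  filter_upwards [Ioo_mem_nhdsLT (zero_lt_one' ℝ)] with r hr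
  exact hbound r hr.1.le hr.2 s

/-- If `1 / u` is a bounded analytic function on the disc, it is the extension to the disc of
some `v ∈ H²`, which is bounded and is the reciprocal of the boundary function of `u`. -/
theorem exists_bounded_boundary_inverse {u : L2} (hu : u ∈ H2)
    (hne : ∀ z ∈ Metric.ball (0 : ℂ) 1, onDisc u z ≠ 0)
    (hinv : IsHInf fun z => (onDisc u z)⁻¹) :
    ∃ v ∈ H2, (∃ C : ℝ, ∀ᵐ x ∂m, ‖v x‖ ≤ C) ∧ ∀ᵐ x ∂m, u x * v x = 1 := by
  obtain ⟨hd, C, hC⟩ := hinv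
  set h : ℂ → ℂ := fun z => (onDisc u z)⁻¹ with hh
  set a : ℕ → ℂ := fun n => (n.factorial : ℂ)⁻¹ * iteratedDeriv n h 0 with ha
  have hsum_a : ∀ z ∈ Metric.ball (0 : ℂ) 1, HasSum (fun n => a n * z ^ n) (h z) := by
    intro z hz
    convert! Complex.hasSum_taylorSeries_on_ball hd hz using 2 with n
    simp only [ha, sub_zero, smul_eq_mul]
    ring
  have hsum_u := fun z hz => hasSum_onDisc u (z := z) hz
  obtain ⟨v, hv⟩ := exists_hasSum_of_summable_sq (summable_sq_of_bounded hsum_a hC)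
  have hu' := hasSum_of_fourierCoeff_neg_eq_zero ((mem_H2_iff u).1 hu)
  let r : ℕ → ℝ := fun k => 1 - 1 / ((k : ℝ) + 1)
  have hr1 : ∀ k, r k < 1 := fun k => by
    have : 0 < 1 / ((k : ℝ) + 1) := by positivity
    simp only [r]; linarith
  have hr0 : ∀ k, 0 ≤ r k := fun k => by
    have : 1 / ((k : ℝ) + 1) ≤ 1 := by
      rw [div_le_one (by positivity)]
      linarith [(Nat.cast_nonneg k : (0 : ℝ) ≤ k)]
    simp only [r]; linarith
  have hr : Tendsto r atTop (𝓝 1) := by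
    simpa [r] using (tendsto_one_div_add_atTop_nhds_zero_nat (𝕜 := ℝ)).const_sub 1
  have htv := tendsto_toLp_radial hsum_a hv hr0 hr1 hr
  have htu := tendsto_toLp_radial hsum_u hu' hr0 hr1 hr
  -- a common subsequence along which the dilations of `u` and of `1 / u` converge a.e.
  obtain ⟨n₁, hn₁, h₁⟩ := (tendstoInMeasure_of_tendsto_Lp htv).exists_seq_tendsto_ae
  obtain ⟨n₂, hn₂, h₂⟩ := (tendstoInMeasure_of_tendsto_Lp
    (htu.comp hn₁.tendsto_atTop)).exists_seq_tendsto_ae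
  have hcv := ae_all_iff.2 fun k =>
    ContinuousMap.coeFn_toLp (p := 2) (𝕜 := ℂ) m (radial a (r k))
  have hcu := ae_all_iff.2 fun k =>
    ContinuousMap.coeFn_toLp (p := 2) (𝕜 := ℂ) m (radial (fun n : ℕ => fourierCoeff u n) (r k))
  refine ⟨v, mem_H2_of_hasSum hv, ⟨C, ?_⟩, ?_⟩
  · filter_upwards [h₁, hcv] with x hx hcx
    refine le_of_tendsto hx.norm (Eventually.of_forall fun k => ?_)
    rw [hcx, radial_apply hsum_a (hr0 _) (hr1 _)]
    exact hC _ (mul_zeta_mem_ball (hr0 _) (hr1 _) x)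
  · filter_upwards [h₁, h₂, hcv, hcu] with x hx hy hcx hcy
    have hxy := hy.mul (hx.comp hn₂.tendsto_atTop)
    refine tendsto_nhds_unique hxy (tendsto_const_nhds.congr fun k => ?_)
    simp only [Function.comp_apply]
    rw [hcx, hcy, radial_apply hsum_a (hr0 _) (hr1 _), radial_apply hsum_u (hr0 _) (hr1 _)]
    exact (mul_inv_cancel₀ (hne _ (mul_zeta_mem_ball (hr0 _) (hr1 _) x))).symm

lemma IsOuter.onDisc_ne_zero {u : L2} (hu : IsOuter u) {z : ℂ}
    (hz : z ∈ Metric.ball (0 : ℂ) 1) : onDisc u z ≠ 0 := by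
  obtain ⟨-, α, k, hα, -, h⟩ := hu
  rw [h z hz]
  refine mul_ne_zero ?_ (Complex.exp_ne_zero _)
  rw [← norm_ne_zero_iff, hα]
  exact one_ne_zero

/-! ### Multiplying a Toeplitz kernel by an outer function -/

/-- If multiplication by `u` carries `Ker T_F` into `H²`, and its inverse, multiplication by the
bounded function `v ∈ H²`, respects the orthogonality conditions that define `Ker T_F` and
`Ker T_G`, then `u Ker T_F = Ker T_G`. -/
lemma mulSet_toeplitzKer_eq {F G : LInf} {u v : L2} {C : ℝ} (hv : v ∈ H2)
    (hvC : ∀ᵐ x ∂m, ‖v x‖ ≤ C) (huv : ∀ᵐ x ∂m, u x * v x = 1)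
    (hsub : mulSet u (toeplitzKer F) ⊆ classes H2)
    (hto : ∀ f p : L2, (∀ᵐ x ∂m, p x = u x * f x) → mulOp F f ∈ H2ᗮ → mulOp G p ∈ H2ᗮ)
    (hfrom : ∀ f p : L2, (∀ᵐ x ∂m, f x = v x * p x) → mulOp G p ∈ H2ᗮ → mulOp F f ∈ H2ᗮ) :
    mulSet u (toeplitzKer F) = classes (toeplitzKer G) := by
  apply Set.Subset.antisymm
  · intro φ hφ
    obtain ⟨p, hp, hφp⟩ := hsub hφ
    obtain ⟨f, hf, hφf⟩ := hφ
    refine ⟨p, (mem_toeplitzKer_iff G p).2 ⟨hp, hto f p ?_ ((mem_toeplitzKer_iff F f).1 hf).2⟩,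
      hφp⟩
    have h := AEEqFun.coeFn_mul (u : T →ₘ[m] ℂ) (f : T →ₘ[m] ℂ)
    rw [← hφf, hφp] at h
    exact h
  · rintro φ ⟨p, hp, rfl⟩
    rw [mem_toeplitzKer_iff] at hp
    have hmem : MemLp (fun x => v x * p x) 2 m := by
      refine (Lp.memLp p).of_le_mul (c := C)
        ((Lp.aestronglyMeasurable v).mul (Lp.aestronglyMeasurable p)) ?_
      filter_upwards [hvC] with x hx
      rw [norm_mul]
      gcongr
    have hq := hmem.coeFn_toLp
    refine ⟨hmem.toLp _, (mem_toeplitzKer_iff F _).2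
      ⟨mem_H2_of_eq_mul hv hp.1 hq, hfrom _ p hq hp.2⟩, ?_⟩
    apply AEEqFun.ext
    filter_upwards [AEEqFun.coeFn_mul (u : T →ₘ[m] ℂ) (hmem.toLp _ : L2).1, hq, huv]
      with x hx hqx huvx
    rw [hx, Pi.mul_apply, hqx, ← mul_assoc, huvx, one_mul]

/-- No condition on the zeros of `u` is needed, the quotient being `0` there. -/
lemma memLp_top_mul_conj_div (F : LInf) (u : L2) :
    MemLp (fun x => F x * conj (u x) / u x) ∞ m := by
  have hm : AEStronglyMeasurable (fun x => F x * conj (u x) / u x) m :=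
    ((Lp.aestronglyMeasurable F).mul
      (Complex.continuous_conj.comp_aestronglyMeasurable (Lp.aestronglyMeasurable u))).div₀
      (Lp.aestronglyMeasurable u)
  refine (Lp.memLp F).of_le hm (Eventually.of_forall fun x => ?_)
  rw [norm_div, norm_mul, RCLike.norm_conj, mul_div_assoc]
  exact mul_le_of_le_one_right (norm_nonneg _) (div_self_le_one _)

lemma memLp_top_div (F : LInf) {u v : L2} {C : ℝ} (hvC : ∀ᵐ x ∂m, ‖v x‖ ≤ C)
    (huv : ∀ᵐ x ∂m, u x * v x = 1) : MemLp (fun x => F x / u x) ∞ m := by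
  refine (Lp.memLp F).of_le_mul (c := C)
    ((Lp.aestronglyMeasurable F).div₀ (Lp.aestronglyMeasurable u)) ?_
  filter_upwards [hvC, huv] with x hx hy
  rw [div_eq_mul_inv, ← eq_inv_of_mul_eq_one_right hy, norm_mul, mul_comm]
  gcongr

end

end HardyToeplitz

open HardyToeplitz MeasureTheory ComplexConjugate ENNReal in
theorem mainTheorem10 (F : LInf) (hF : F ≠ 0) (u : L2) (hu : IsOuter u)
    (hinv : IsHInf fun z => (onDisc u z)⁻¹)
    (hker : toeplitzKer F ≠ ⊥)
    (hsub : mulSet u (toeplitzKer F) ⊆ classes H2) :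
    (∃ (h₁ : MemLp (fun x => F x * conj (u x) / u x) ∞ m)
       (h₂ : MemLp (fun x => F x / u x) ∞ m),
        mulSet u (toeplitzKer F) = classes (toeplitzKer (h₁.toLp _)) ∧
        classes (toeplitzKer (h₁.toLp _)) = classes (toeplitzKer (h₂.toLp _))) ∧
    IsToeplitzKernel (mulSet u (toeplitzKer F)) := by
  obtain ⟨v, hv, ⟨C, hvC⟩, huv⟩ :=
    exists_bounded_boundary_inverse hu.1 (fun _ => hu.onDisc_ne_zero) hinv
  have h₁ := memLp_top_mul_conj_div F u
  have h₂ := memLp_top_div F hvC huv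
  have e₁ : mulSet u (toeplitzKer F) = classes (toeplitzKer (h₁.toLp _)) := by
    refine mulSet_toeplitzKer_eq hv hvC huv hsub (fun f p hp hf => ?_) (fun f p hf hp => ?_)
    · refine mem_orthogonal_H2_of_eq_mul_conj hf hu.1 ?_
      filter_upwards [hp, huv, h₁.coeFn_toLp, coeFn_mulOp (h₁.toLp _) p, coeFn_mulOp F f]
        with x hpx hx hGx hGp hFf
      have hux : u x ≠ 0 := left_ne_zero_of_mul_eq_one hx
      rw [hGp, hGx, hFf, hpx]
      field_simp
    · refine mem_orthogonal_H2_of_eq_mul_conj hp hv ?_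
      filter_upwards [hf, huv, h₁.coeFn_toLp, coeFn_mulOp (h₁.toLp _) p, coeFn_mulOp F f]
        with x hfx hx hGx hGp hFf
      have hc : conj (u x) * conj (v x) = 1 := by rw [← map_mul, hx, map_one]
      rw [hFf, hGp, hGx, hfx, div_eq_mul_inv, ← eq_inv_of_mul_eq_one_right hx]
      linear_combination -(F x * v x * p x) * hc
  have e₂ : mulSet u (toeplitzKer F) = classes (toeplitzKer (h₂.toLp _)) := by
    refine mulSet_toeplitzKer_eq hv hvC huv hsub (fun f p hp hf => ?_) (fun f p hf hp => ?_)
    · convert hf using 1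
      apply Lp.ext
      filter_upwards [hp, huv, h₂.coeFn_toLp, coeFn_mulOp (h₂.toLp _) p, coeFn_mulOp F f]
        with x hpx hx hGx hGp hFf
      have hux : u x ≠ 0 := left_ne_zero_of_mul_eq_one hx
      rw [hGp, hGx, hFf, hpx]
      field_simp
    · convert hp using 1
      apply Lp.ext
      filter_upwards [hf, huv, h₂.coeFn_toLp, coeFn_mulOp (h₂.toLp _) p, coeFn_mulOp F f]
        with x hfx hx hGx hGp hFf
      rw [hFf, hGp, hGx, hfx, div_eq_mul_inv, ← eq_inv_of_mul_eq_one_right hx, mul_assoc]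
  exact ⟨⟨h₁, h₂, e₁, e₁.symm.trans e₂⟩, _, e₁⟩
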